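/- All graphs are finite and simple. The treedepth $\mathrm{td}(G)$ of a graph $G$ is the least integer $d\ge 0$ for which there is a rooted forest $F$ of depth at most $d-1$ (that is, with at most $d$ levels) with vertex set $V(G)$ such that every edge of $G$ joins a vertex to one of its ancestors or descendants in $F$. For a function $r\colon\mathbb N\to\mathbb R_{\ge 0}$, a graph $G$ is fractionally $\mathrm{td}$-fragile at rate $r$ if for every integer $a\ge 1$ there is a probability distribution on the sets $Y\subseteq V(G)$ with $\mathrm{td}(G-Y)\le r(a)$ such that each vertex of $G$ belongs to the random set $Y$ with probability at most $1/a$. A graph is outerplanar if it can be drawn in the plane without crossings so that all its vertices lie on the boundary of the outer face. Let $P_n$ be the path with $n$ vertices. For a graph $H$ and an integer $d\ge 0$, the graph $T_d(H)$ is defined as follows: $T_0(H)$ is a single vertex, its handle; for $d\ge 1$, $T_d(H)$ is obtained from $H$ by adding, for each $x\in V(H)$, a copy of $T_{d-1}(H)$ and identifying its handle with $x$, and finally adding a new vertex, the handle of $T_d(H)$, adjacent to all vertices of $H$. Theorem. (i) For all integers $d\ge 0$, $a\ge 1$ and $n\ge 2^a$, $\mathrm{td}(T_d(P_n))\ge ad+1$.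 (ii) For every integer $d\ge 0$, the graph $T_d(P_d)$ is outerplanar. There are constants $c>0$ and $a_0\in\mathbb N$ such that for all integers $d\ge a\ge a_0$ and every non-decreasing function $r\colon\mathbb N\to\mathbb R_{\ge 0}$, if $T_d(P_d)$ is fractionally $\mathrm{td}$-fragile at rate $r$, then $r(a)\ge c\,a\log a$. (iii) Let $r\colon\mathbb N\to\mathbb R_{\ge 0}$ be a non-decreasing function. If all outerplanar graphs are fractionally $\mathrm{td}$-fragile at rate $r$, then $r(a)=\Omega(a\log a)$ as $a\to\infty$. -/

import Mathlib

open scoped NNReal Topology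

namespace TdFragile

/-! ## Treedepth -/

/-- A rooted forest with vertex set `V`: `parent v = none` means that `v` is a root, and `depth v`
is the number of edges between `v` and the root of its tree (the two depth conditions determine
`depth` from `parent`, and rule out cycles and infinite ascending sequences of parents). -/
structure RootedForest (V : Type*) where
  parent : V → Option V
  depth : V → ℕ
  depth_root : ∀ v, parent v = none → depth v = 0
  depth_child : ∀ v u, parent v = some u → depth v = depth u + 1

/-- `u` is `v` itself or one of the vertices on the path from `v` to the root of its tree. -/
def RootedForest.IsAncestor {V : Type*} (F : RootedForest V) (u v : V) : Prop :=
  Relation.ReflTransGen (fun x y => F.parent x = some y) v u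

/-- `F` has depth at most `d - 1` (that is, at most `d` levels), and every edge of `G` joins a
vertex to one of its ancestors or descendants in `F`. -/
def RootedForest.Witnesses {V : Type*} (F : RootedForest V) (G : SimpleGraph V) (d : ℕ) : Prop :=
  (∀ v, F.depth v < d) ∧ ∀ u v, G.Adj u v → F.IsAncestor u v ∨ F.IsAncestor v u

/-- The treedepth of a (finite) graph. -/
noncomputable def treedepth {V : Type*} (G : SimpleGraph V) : ℕ :=
  sInf {d | ∃ F : RootedForest V, F.Witnesses G d}

/-- Treedepth as a real-valued graph parameter. -/
noncomputable def td (V : Type) (G : SimpleGraph V) : ℝ := treedepth G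

/-! ## Fractional fragility -/

/-- The sets `Y` of vertices of `G` such that `f (G - Y) ≤ b`. -/
def deletionSets (f : (V : Type) → SimpleGraph V → ℝ) {V : Type} (G : SimpleGraph V) (b : ℝ) :
    Set (Finset V) :=
  {Y | f {v : V // v ∉ Y} (G.induce {v : V | v ∉ Y}) ≤ b}

open Classical in
/-- A probability distribution `μ` on the subsets of `V` is `ε`-thin if every vertex belongs
to a random set sampled from `μ` with probability at most `ε`. -/
def IsThin {V : Type} [Fintype V] (μ : Finset V → ℝ) (ε : ℝ) : Prop :=
  ∀ v : V, ∑ X : Finset V with v ∈ X, μ X ≤ ε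

/-- `G` is fractionally `f`-fragile at rate `r`. The elements `μ` of
`stdSimplex ℝ (Finset V)` are the probability distributions on the subsets of `V`. -/
def FractionallyFragile (f : (V : Type) → SimpleGraph V → ℝ) (r : ℕ → ℝ≥0)
    {V : Type} [Fintype V] (G : SimpleGraph V) : Prop :=
  ∀ a : ℕ, 1 ≤ a → ∃ μ ∈ stdSimplex ℝ (Finset V),
    IsThin μ (1 / (a : ℝ)) ∧ ∀ X, μ X ≠ 0 → X ∈ deletionSets f G (r a)

/-! ## Outerplanar graphs -/

/-- `A` is a simple arc in the plane with ends `p` and `q`. -/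
def IsArc (A : Set (ℝ × ℝ)) (p q : ℝ × ℝ) : Prop :=
  ∃ γ : Path p q, Function.Injective γ ∧ Set.range γ = A

/-- A drawing of `G` in the plane without crossings: vertices are distinct points, an edge `uv`
is a simple arc between the points of `u` and `v` containing no other vertex, and two distinct
edges may only meet in points that represent vertices (hence only in common end-vertices). -/
structure PlaneDrawing {V : Type*} (G : SimpleGraph V) where
  point : V → ℝ × ℝ
  arc : Sym2 V → Set (ℝ × ℝ)
  point_injective : Function.Injective point
  isArc : ∀ u v, G.Adj u v → IsArc (arc s(u, v)) (point u) (point v)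
  mem_of_point_mem_arc : ∀ e ∈ G.edgeSet, ∀ w, point w ∈ arc e → w ∈ e
  arc_inter_arc : ∀ e ∈ G.edgeSet, ∀ e' ∈ G.edgeSet, e ≠ e' → arc e ∩ arc e' ⊆ Set.range point

/-- The set of points of the plane covered by the drawing. -/
def PlaneDrawing.support {V : Type*} {G : SimpleGraph V} (D : PlaneDrawing G) : Set (ℝ × ℝ) :=
  Set.range D.point ∪ ⋃ e ∈ G.edgeSet, D.arc e

/-- The unbounded component of the complement of the (compact) set `K` in the plane. -/
def outerFace (K : Set (ℝ × ℝ)) : Set (ℝ × ℝ) :=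
  {x | x ∈ Kᶜ ∧ ¬ Bornology.IsBounded (connectedComponentIn Kᶜ x)}

/-- A (finite) graph is outerplanar if it has a drawing in the plane without crossings in which
all vertices lie on the boundary of the outer face. -/
def IsOuterplanar {V : Type*} (G : SimpleGraph V) : Prop :=
  ∃ D : PlaneDrawing G, ∀ v, D.point v ∈ closure (outerFace D.support)

/-! ## The graphs `T_d(H)` -/

/-- The vertices of `T_d(H)`, where `H` has vertex set `W`. In `T_{d+1}(H)`, `none` is the handle,
and `some (x, y)` is the vertex `y` of the copy of `T_d(H)` attached at the vertex `x` of `H`.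
The vertex `x` of `H` is identified with the handle of that copy. -/
def TVert (W : Type) : ℕ → Type
  | 0 => Unit
  | d + 1 => Option (W × TVert W d)

instance TVert.instFintype (W : Type) [Fintype W] : (d : ℕ) → Fintype (TVert W d)
  | 0 => inferInstanceAs (Fintype Unit)
  | d + 1 =>
    letI := TVert.instFintype W d
    inferInstanceAs (Fintype (Option (W × TVert W d)))

/-- The handle of `T_d(H)`. -/
def handle (W : Type) : (d : ℕ) → TVert W d
  | 0 => ()
  | _ + 1 => none

/-- Adjacency in `T_d(H)`: the handle of `T_{d+1}(H)` is adjacent to the vertices of `H` (the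
handles of the copies of `T_d(H)`); the other edges are those of the copies and those of `H`. -/
def TAdj {W : Type} (H : SimpleGraph W) : (d : ℕ) → TVert W d → TVert W d → Prop
  | 0, _, _ => False
  | _ + 1, none, none => False
  | d + 1, none, some (_, y) => y = handle W d
  | d + 1, some (_, y), none => y = handle W d
  | d + 1, some (x, y), some (x', y') =>
      (x = x' ∧ TAdj H d y y') ∨ (H.Adj x x' ∧ y = handle W d ∧ y' = handle W d)

theorem TAdj.symm {W : Type} (H : SimpleGraph W) :
    (d : ℕ) → (u v : TVert W d) → TAdj H d u v → TAdj H d v u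
  | 0, _, _, h => h
  | _ + 1, none, none, h => h
  | _ + 1, none, some (_, _), h => h
  | _ + 1, some (_, _), none, h => h
  | d + 1, some (_, y), some (_, y'), h => by
      rcases h with ⟨h1, h2⟩ | ⟨h1, h2, h3⟩
      · exact Or.inl ⟨h1.symm, TAdj.symm H d y y' h2⟩
      · exact Or.inr ⟨h1.symm, h3, h2⟩

theorem TAdj.irrefl {W : Type} (H : SimpleGraph W) :
    (d : ℕ) → (u : TVert W d) → ¬ TAdj H d u u
  | 0, _, h => h
  | _ + 1, none, h => h
  | d + 1, some (x, y), h => by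
      rcases h with ⟨_, h2⟩ | ⟨h1, _⟩
      · exact TAdj.irrefl H d y h2
      · exact H.irrefl h1

/-- The graph `T_d(H)`. -/
def T {W : Type} (d : ℕ) (H : SimpleGraph W) : SimpleGraph (TVert W d) where
  Adj := TAdj H d
  symm := ⟨fun u v h => TAdj.symm H d u v h⟩
  loopless := ⟨fun u h => TAdj.irrefl H d u h⟩

end TdFragile

/-!
**Rows.** Consider disjoint connected sets `C x`, indexed by consecutive vertices of a path and
joined by edges along it. Some vertex of a piece `C x` can be removed from their union so that the
treedepth drops, and the pieces on either side of `C x` form two rows of treedepth at most one less.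
By induction, a row of treedepth `t` has at most `2 ^ (t + 1 - u) - 1` pieces of treedepth at least
`u`, which gives the lower bound on `td (T_d(P_n))`, and more generally
`∑ exp (td (C x)) ≤ 4 * exp (td (⋃ C x))`.

**Fragility.** By averaging, fragility at rate `r` can be tested against any weighting of the
vertices: some admissible set has weight at most a `1 / a` fraction of the total. The weights used
here spread a unit of mass uniformly over each of the levels `0, …, k` of `T_d(P_n)`. The component
of the handle in `T_d(P_n) - Y` contains a row of components of handles of copies, one for each copy
whose handle is not in `Y`, and by the bound on exponential sums and the concavity of the logarithm
its treedepth exceeds the average over the copies by about `log a`, up to an error paid for by the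
weight of `Y`. Over `k ≈ a / 4` levels this accumulates to a constant times `a * log a`.

**Outerplanarity.** Put the vertices on the parabola `y = x ^ 2`, the handle first and then the
copies one after another, and draw the edges as chords. Two chords cross only if their ends
interleave, and the unbounded region below the parabola meets no chord.
-/

namespace TdFragile

open SimpleGraph

/-! ### Treedepth -/

section Treedepth

variable {V W : Type*} {G : SimpleGraph V} {H : SimpleGraph W}

theorem RootedForest.IsAncestor.eq_or_depth_lt {F : RootedForest V} {u v : V}
    (h : F.IsAncestor u v) : u = v ∨ F.depth u < F.depth v := by
  induction h with
  | refl => exact Or.inl rfl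
  | tail _ hparent ih =>
    have := F.depth_child _ _ hparent
    rcases ih with rfl | ih <;> right <;> omega

theorem RootedForest.IsAncestor.total {F : RootedForest V} {u v w : V}
    (hu : F.IsAncestor u w) (hv : F.IsAncestor v w) : F.IsAncestor u v ∨ F.IsAncestor v u :=
  Relation.ReflTransGen.total_of_right_unique
    (fun _ _ _ h h' => Option.some_injective _ (h.symm.trans h')) hv hu

theorem RootedForest.injOn_depth_ancestors (F : RootedForest V) (v : V) :
    Set.InjOn F.depth {u | F.IsAncestor u v} := by
  intro u hu w hw huw
  rcases hu.total hw with h | h <;> rcases h.eq_or_depth_lt with h | h <;> first | omega | simp [h]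

/-- The order of a rooted forest in which the ancestors of a vertex are the elements above it. -/
abbrev RootedForest.partialOrder (F : RootedForest V) : PartialOrder V where
  le v u := F.IsAncestor u v
  le_refl _ := Relation.ReflTransGen.refl
  le_trans _ _ _ := Relation.ReflTransGen.trans
  le_antisymm _ _ huv hvu := by
    rcases huv.eq_or_depth_lt with h | h
    · exact h.symm
    · exact hvu.eq_or_depth_lt.resolve_right h.asymm

section OfPartialOrder

variable [PartialOrder V]

theorem Ioi_eq_Ici_of_covBy (hchain : ∀ v : V, IsChain (· ≤ ·) (Set.Ici v)) {v p : V}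
    (hp : v ⋖ p) : Set.Ioi v = Set.Ici p := by
  ext w
  refine ⟨fun hw => ?_, hp.lt.trans_le⟩
  rcases (hchain v).total hp.le (le_of_lt hw) with h | h
  · exact h
  · exact (h.eq_or_lt.resolve_right (hp.2 hw)).ge

variable [Finite V]

open Classical in
/-- The rooted forest of a finite partial order whose principal upper sets are chains: the parent
of an element is the element covering it. -/
noncomputable def RootedForest.ofPartialOrder
    (hchain : ∀ v : V, IsChain (· ≤ ·) (Set.Ici v)) : RootedForest V where
  parent v := if h : ∃ p, v ⋖ p then some h.choose else none
  depth v := (Set.Ioi v).ncard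
  depth_root v h := by
    rw [Set.ncard_eq_zero, Set.eq_empty_iff_forall_notMem]
    intro w hw
    obtain ⟨p, hp, -⟩ := hw.exists_covby_le
    simp [show ∃ p, v ⋖ p from ⟨p, hp⟩] at h
  depth_child v p h := by
    have hp : v ⋖ p := by
      split_ifs at h with hex
      exact Option.some_injective _ h ▸ hex.choose_spec
    rw [Ioi_eq_Ici_of_covBy hchain hp, ← Set.Ioi_insert, Set.ncard_insert_of_notMem (by simp)]

theorem RootedForest.isAncestor_ofPartialOrder (hchain : ∀ v : V, IsChain (· ≤ ·) (Set.Ici v))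
    {u v : V} (h : v ≤ u) : (RootedForest.ofPartialOrder hchain).IsAncestor u v := by
  induction v using WellFoundedGT.induction with
  | ind v ih =>
    rcases h.eq_or_lt with rfl | h
    · exact Relation.ReflTransGen.refl
    · have hex : ∃ p, v ⋖ p := h.exists_covby_le.imp fun _ hp => hp.1
      have hu : u ∈ Set.Ici hex.choose := Ioi_eq_Ici_of_covBy hchain hex.choose_spec ▸ h
      exact .head (by simp [ofPartialOrder, hex]) (ih _ hex.choose_spec.lt hu)

theorem RootedForest.witnesses_ofPartialOrder (hchain : ∀ v : V, IsChain (· ≤ ·) (Set.Ici v))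
    {G : SimpleGraph V} (hadj : ∀ u v, G.Adj u v → u ≤ v ∨ v ≤ u) {d : ℕ}
    (hd : ∀ v : V, (Set.Ioi v).ncard < d) : (RootedForest.ofPartialOrder hchain).Witnesses G d :=
  ⟨hd, fun u v h => (hadj u v h).symm.imp (isAncestor_ofPartialOrder hchain)
    (isAncestor_ofPartialOrder hchain)⟩

end OfPartialOrder

theorem exists_witnesses_treedepth [Finite V] (G : SimpleGraph V) :
    ∃ F : RootedForest V, F.Witnesses G (treedepth G) := by
  let := LinearOrder.lift' _ (Finite.equivFin V).injective
  have hchain (v : V) : IsChain (· ≤ ·) (Set.Ici v) :=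
    fun u _ w _ _ => le_total u w
  have hwit : (RootedForest.ofPartialOrder hchain).Witnesses G (Nat.card V + 1) :=
    RootedForest.witnesses_ofPartialOrder hchain (fun u v _ => le_total u v)
      fun v => Nat.lt_succ_of_le (Set.ncard_le_card _)
  exact Nat.sInf_mem (s := {d | ∃ F : RootedForest V, F.Witnesses G d}) ⟨_, _, hwit⟩

theorem one_le_treedepth [Finite V] [Nonempty V] (G : SimpleGraph V) : 1 ≤ treedepth G := by
  obtain ⟨F, hd, -⟩ := exists_witnesses_treedepth G
  exact Nat.one_le_of_lt (hd (Classical.arbitrary V))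

theorem RootedForest.treedepth_le_of_copy [Finite V] {F : RootedForest W}
    (hF : ∀ u v, H.Adj u v → F.IsAncestor u v ∨ F.IsAncestor v u) (f : Copy G H) {k d : ℕ}
    (hk : ∀ v, k ≤ F.depth (f v)) (hd : ∀ v, F.depth (f v) < k + d) : treedepth G ≤ d := by
  let := F.partialOrder
  let : PartialOrder V := .lift f f.injective
  have hchain (v : V) : IsChain (· ≤ ·) (Set.Ici v) :=
    fun u hu w hw _ => (RootedForest.IsAncestor.total (F := F) hu hw).symm
  refine Nat.sInf_le ⟨RootedForest.ofPartialOrder hchain, RootedForest.witnesses_ofPartialOrder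
    hchain (fun u v h => (hF _ _ (f.toHom.map_adj h)).symm) fun v => ?_⟩
  have hanc {u v : V} (h : u ∈ Set.Ioi v) : F.IsAncestor (f u) (f v) :=
    le_of_lt (Set.mem_Ioi.1 h)
  have hmaps : Set.MapsTo (F.depth ∘ f) (Set.Ioi v) (Set.Ico k (F.depth (f v))) := fun u hu =>
    ⟨hk u, (hanc hu).eq_or_depth_lt.resolve_left fun h => (Set.mem_Ioi.1 hu).ne' (f.injective h)⟩
  have hinj : Set.InjOn (F.depth ∘ f) (Set.Ioi v) := fun u hu w hw h =>
    f.injective (F.injOn_depth_ancestors (f v) (hanc hu) (hanc hw) h)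
  have hcard := Set.ncard_le_ncard_of_injOn _ hmaps hinj
  rw [← Finset.coe_Ico, Set.ncard_coe_finset, Nat.card_Ico] at hcard
  have := hk v
  have := hd v
  omega

theorem treedepth_mono [Finite V] [Finite W] (h : G ⊑ H) : treedepth G ≤ treedepth H := by
  obtain ⟨f⟩ := h
  obtain ⟨F, hd, hF⟩ := exists_witnesses_treedepth H
  exact F.treedepth_le_of_copy hF f (k := 0) (by simp) (by simpa using fun v => hd (f v))

theorem treedepth_induce_le_image [Finite V] [Finite W] (f : Copy G H) (S : Set V) :
    treedepth (G.induce S) ≤ treedepth (H.induce (f '' S)) :=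
  treedepth_mono ⟨⟨induceHom f.toHom (Set.mapsTo_image f S), fun _ _ huv =>
    Subtype.ext (f.injective (congrArg Subtype.val huv))⟩⟩

theorem connected_induce_image (f : G →g H) {S : Set V} (hS : (G.induce S).Connected) :
    (H.induce (f '' S)).Connected :=
  hS.map (induceHom f (Set.mapsTo_image f S)) fun ⟨_, v, hv, rfl⟩ => ⟨⟨v, hv⟩, rfl⟩

theorem treedepth_induce_mono [Finite V] (G : SimpleGraph V) {C D : Set V} (h : C ⊆ D) :
    treedepth (G.induce C) ≤ treedepth (G.induce D) :=
  treedepth_mono (G.induceHomOfLE h).isContained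

theorem RootedForest.exists_forall_isAncestor {F : RootedForest V} (hG : G.Connected)
    (hF : ∀ u v, G.Adj u v → F.IsAncestor u v ∨ F.IsAncestor v u) :
    ∃ z, ∀ v, F.IsAncestor z v := by
  have := hG.nonempty
  obtain ⟨z, hz⟩ : ∃ z, ∀ v, F.depth z ≤ F.depth v :=
    ⟨Function.argmin F.depth, fun v => Function.argmin_le F.depth v⟩
  refine ⟨z, fun v => ?_⟩
  have hzv := (reachable_iff_reflTransGen z v).1 (hG.preconnected z v)
  induction hzv with
  | refl => exact .refl
  | tail _ hadj ih =>
    rcases hF _ _ hadj with h | h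
    · exact h.trans ih
    · rcases ih.total h with h' | h'
      · exact h'
      · rcases h'.eq_or_depth_lt with rfl | hlt
        · exact .refl
        · exact absurd hlt ((hz _).not_gt)

theorem exists_treedepth_induce_diff_singleton_lt [Finite V] {C : Set V}
    (hC : (G.induce C).Connected) :
    ∃ z ∈ C, treedepth (G.induce (C \ {z})) < treedepth (G.induce C) := by
  obtain ⟨F, hd, hF⟩ := exists_witnesses_treedepth (G.induce C)
  obtain ⟨z, hz⟩ := RootedForest.exists_forall_isAncestor hC hF
  refine ⟨z, z.2, ?_⟩
  have hpos : 0 < treedepth (G.induce C) := (Nat.zero_le _).trans_lt (hd z)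
  suffices treedepth (G.induce (C \ {z.1})) ≤ treedepth (G.induce C) - 1 by omega
  refine F.treedepth_le_of_copy hF (G.induceHomOfLE Set.sdiff_subset).toCopy (k := 1) ?_ ?_
  · intro v
    have hne : z ≠ G.induceHomOfLE Set.sdiff_subset v :=
      fun h => v.2.2 (congrArg Subtype.val h.symm)
    exact Nat.one_le_of_lt ((hz _).eq_or_depth_lt.resolve_left hne)
  · intro v
    have := hd (G.induceHomOfLE Set.sdiff_subset v)
    exact this.trans_eq (by omega)

end Treedepth

/-! ### Rows of pieces -/

section Row

variable {V ι : Type*} [LinearOrder ι] {G : SimpleGraph V} {C : ι → Set V}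

/-- The pieces `C x`, for `x ∈ I`, form a row in `G`: they induce connected subgraphs, are pairwise
disjoint, and any two of them with consecutive indices are joined by an edge. -/
structure IsRow (G : SimpleGraph V) (C : ι → Set V) (I : Set ι) : Prop where
  connected : ∀ x ∈ I, (G.induce (C x)).Connected
  pairwiseDisjoint : I.PairwiseDisjoint C
  exists_adj : ∀ x ∈ I, ∀ y ∈ I, x ⋖ y → ∃ u ∈ C x, ∃ v ∈ C y, G.Adj u v

theorem IsRow.mono {I J : Set ι} (h : IsRow G C J) (hIJ : I ⊆ J) : IsRow G C I where
  connected x hx := h.connected x (hIJ hx)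
  pairwiseDisjoint := h.pairwiseDisjoint.subset hIJ
  exists_adj x hx y hy := h.exists_adj x (hIJ hx) y (hIJ hy)

theorem IsRow.connected_biUnion_Icc [SuccOrder ι] [IsSuccArchimedean ι] {x y : ι} (hxy : x ≤ y)
    (h : IsRow G C (Set.Icc x y)) : (G.induce (⋃ z ∈ Set.Icc x y, C z)).Connected := by
  induction hxy using Succ.rec with
  | rfl =>
    rw [Set.Icc_self, Set.biUnion_singleton]
    exact h.connected x (Set.left_mem_Icc.2 le_rfl)
  | succ y hxy ih =>
    by_cases hmax : IsMax y
    · rw [hmax.succ_eq] at h ⊢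
      exact ih h
    · have hmem : Order.succ y ∈ Set.Icc x (Order.succ y) := ⟨hxy.trans (Order.le_succ y), le_rfl⟩
      have hle : Set.Icc x y ⊆ Set.Icc x (Order.succ y) :=
        Set.Icc_subset_Icc_right (Order.le_succ y)
      obtain ⟨u, hu, v, hv, huv⟩ := h.exists_adj y (hle ⟨hxy, le_rfl⟩) _ hmem
        (Order.covBy_succ_of_not_isMax hmax)
      rw [Order.Icc_succ_right hmem.1, Set.biUnion_insert]
      exact connected_induce_union (h.connected _ hmem).preconnected (ih (h.mono hle)).preconnected
        hv (Set.mem_biUnion (Set.right_mem_Icc.2 hxy) hu) huv.symm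

theorem IsRow.connected_biUnion [SuccOrder ι] [IsSuccArchimedean ι] {I : Set ι}
    (hI : I.OrdConnected) (hne : I.Nonempty) (h : IsRow G C I) :
    (G.induce (⋃ x ∈ I, C x)).Connected := by
  obtain ⟨x, hx⟩ := hne
  obtain ⟨⟨u, hu⟩⟩ := (h.connected x hx).nonempty
  refine induce_connected_of_patches u (Set.mem_biUnion hx hu) fun {v} hv => ?_
  obtain ⟨y, hy, hvy⟩ := Set.mem_iUnion₂.1 hv
  have huIcc := hI.uIcc_subset hx hy
  refine ⟨_, Set.biUnion_mono huIcc fun _ _ => subset_rfl, Set.mem_biUnion Set.left_mem_uIcc hu,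
    Set.mem_biUnion Set.right_mem_uIcc hvy, ?_⟩
  refine Connected.preconnected ?_ _ _
  rcases le_total x y with hxy | hxy
  · rw [Set.uIcc_of_le hxy] at huIcc ⊢
    exact (h.mono huIcc).connected_biUnion_Icc hxy
  · rw [Set.uIcc_of_ge hxy] at huIcc ⊢
    exact (h.mono huIcc).connected_biUnion_Icc hxy

variable [Finite V]

theorem IsRow.exists_treedepth_lt [SuccOrder ι] [IsSuccArchimedean ι] {I : Set ι}
    (hI : I.OrdConnected) (hne : I.Nonempty) (h : IsRow G C I) :
    ∃ x ∈ I, ∀ J ⊆ I, x ∉ J →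
      treedepth (G.induce (⋃ y ∈ J, C y)) < treedepth (G.induce (⋃ y ∈ I, C y)) := by
  obtain ⟨z, hz, hlt⟩ := exists_treedepth_induce_diff_singleton_lt (h.connected_biUnion hI hne)
  obtain ⟨x, hx, hzx⟩ := Set.mem_iUnion₂.1 hz
  refine ⟨x, hx, fun J hJ hxJ => (treedepth_induce_mono G ?_).trans_lt hlt⟩
  refine Set.subset_sdiff_singleton (Set.biUnion_mono hJ fun _ _ => subset_rfl) fun hzJ => ?_
  obtain ⟨y, hy, hzy⟩ := Set.mem_iUnion₂.1 hzJ
  have hyx : y ≠ x := fun hyx => hxJ (hyx ▸ hy)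
  exact (h.pairwiseDisjoint (hJ hy) hx hyx).ne_of_mem hzy hzx rfl

theorem sum_eq_sum_lt_add_sum_gt_add {M : Type*} [AddCommMonoid M] {I : Finset ι} {x : ι}
    (hx : x ∈ I) (f : ι → M) :
    ∑ y ∈ I, f y = ∑ y ∈ I with y < x, f y + ∑ y ∈ I with x < y, f y + f x := by
  rw [← Finset.sum_filter_add_sum_filter_not I (· < x) f, add_assoc]
  congr 1
  have hnot : I.filter (¬ · < x) = insert x (I.filter (x < ·)) := by
    ext y
    simp only [Finset.mem_filter, Finset.mem_insert, not_lt, le_iff_eq_or_lt]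
    grind
  rw [hnot, Finset.sum_insert (by simp), add_comm]

theorem ordConnected_filter_lt {I : Finset ι} (hI : (I : Set ι).OrdConnected) (x : ι) :
    (I.filter (· < x) : Set ι).OrdConnected := by
  rw [Finset.coe_filter]
  exact hI.inter Set.ordConnected_Iio

theorem ordConnected_filter_gt {I : Finset ι} (hI : (I : Set ι).OrdConnected) (x : ι) :
    (I.filter (x < ·) : Set ι).OrdConnected := by
  rw [Finset.coe_filter]
  exact hI.inter Set.ordConnected_Ioi

section Weight

variable [SuccOrder ι] [IsSuccArchimedean ι] {M : Type*} [AddCommMonoid M] [PartialOrder M]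
  [IsOrderedAddMonoid M] {f g : ℕ → M} {I : Finset ι} {t : ℕ}

theorem IsRow.sum_treedepth_le (hf : Monotone f) (hg : ∀ t, 0 ≤ g t)
    (hfg : ∀ t, g t + g t + f (t + 1) ≤ g (t + 1)) (hI : (I : Set ι).OrdConnected)
    (h : IsRow G C I) (ht : treedepth (G.induce (⋃ x ∈ I, C x)) ≤ t) :
    ∑ x ∈ I, f (treedepth (G.induce (C x))) ≤ g t := by
  induction t generalizing I with
  | zero =>
    rcases I.eq_empty_or_nonempty with rfl | hne
    · simpa using hg 0
    · obtain ⟨x, -, hlt⟩ := h.exists_treedepth_lt hI hne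
      exact absurd ((hlt ∅ (Set.empty_subset _) (Set.notMem_empty x)).trans_le ht) (by simp)
  | succ t ih =>
    rcases I.eq_empty_or_nonempty with rfl | hne
    · simpa using hg (t + 1)
    obtain ⟨x, hx, hlt⟩ := h.exists_treedepth_lt hI hne
    have hpart (J : Finset ι) (hJ : (J : Set ι).OrdConnected) (hJI : J ⊆ I) (hxJ : x ∉ J) :
        ∑ y ∈ J, f (treedepth (G.induce (C y))) ≤ g t :=
      ih hJ (h.mono hJI) (Nat.le_of_lt_succ ((hlt J hJI hxJ).trans_le ht))
    have hpiece : treedepth (G.induce (C x)) ≤ t + 1 :=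
      (treedepth_induce_mono G (Set.subset_biUnion_of_mem hx)).trans ht
    rw [sum_eq_sum_lt_add_sum_gt_add hx]
    exact le_trans (add_le_add (add_le_add
      (hpart _ (ordConnected_filter_lt hI x) (Finset.filter_subset _ I) (by simp))
      (hpart _ (ordConnected_filter_gt hI x) (Finset.filter_subset _ I) (by simp)))
      (hf hpiece)) (hfg t)

/-- Removing the pieces with indices in `D` cuts the row into at most `#(I ∩ D) + 1` rows. -/
theorem IsRow.sum_treedepth_sdiff_le (hf : Monotone f) (hg : ∀ t, 0 ≤ g t)
    (hfg : ∀ t, g t + g t + f (t + 1) ≤ g (t + 1)) (D : Finset ι)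
    (hI : (I : Set ι).OrdConnected) (h : IsRow G C (I \ D : Finset ι))
    (ht : treedepth (G.induce (⋃ x ∈ I \ D, C x)) ≤ t) :
    ∑ x ∈ I \ D, f (treedepth (G.induce (C x))) ≤ ((I ∩ D).card + 1) • g t := by
  induction I using Finset.strongInduction with
  | H I ih =>
    rcases (I ∩ D).eq_empty_or_nonempty with hdisj | ⟨x, hx⟩
    · rw [Finset.sdiff_eq_self_of_disjoint (Finset.disjoint_iff_inter_eq_empty.2 hdisj)] at h ht ⊢
      simpa [hdisj] using h.sum_treedepth_le hf hg hfg hI ht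
    obtain ⟨hxI, hxD⟩ := Finset.mem_inter.1 hx
    have hpart (J : Finset ι) (hJ : (J : Set ι).OrdConnected) (hJI : J ⊆ I) (hxJ : x ∉ J) :
        ∑ y ∈ J \ D, f (treedepth (G.induce (C y))) ≤ ((J ∩ D).card + 1) • g t := by
      have hJD : J \ D ⊆ I \ D := Finset.sdiff_subset_sdiff hJI subset_rfl
      exact ih J (hJI.ssubset_of_mem_notMem hxI hxJ) hJ (h.mono hJD)
        ((treedepth_induce_mono G (Set.biUnion_mono hJD fun _ _ => subset_rfl)).trans ht)
    have hleft := hpart _ (ordConnected_filter_lt hI x) (Finset.filter_subset _ I) (by simp)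
    have hright := hpart _ (ordConnected_filter_gt hI x) (Finset.filter_subset _ I) (by simp)
    have hsum (J : Finset ι) : ∑ y ∈ J \ D, f (treedepth (G.induce (C y))) =
        ∑ y ∈ J, if y ∉ D then f (treedepth (G.induce (C y))) else 0 := by
      rw [Finset.sdiff_eq_filter, Finset.sum_filter]
    have hcard (J : Finset ι) : (J ∩ D).card = ∑ y ∈ J, if y ∈ D then 1 else 0 := by
      rw [← Finset.filter_mem_eq_inter, Finset.card_filter]
    calc ∑ y ∈ I \ D, f (treedepth (G.induce (C y)))
        = ∑ y ∈ I.filter (· < x) \ D, f (treedepth (G.induce (C y))) +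
          ∑ y ∈ I.filter (x < ·) \ D, f (treedepth (G.induce (C y))) := by
          simp only [hsum, sum_eq_sum_lt_add_sum_gt_add hxI, hxD, not_true, if_false, add_zero]
      _ ≤ ((I.filter (· < x) ∩ D).card + 1) • g t + ((I.filter (x < ·) ∩ D).card + 1) • g t :=
          add_le_add hleft hright
      _ = ((I ∩ D).card + 1) • g t := by
          rw [← add_nsmul, hcard I, sum_eq_sum_lt_add_sum_gt_add hxI, ← hcard, ← hcard, if_pos hxD]
          congr 1
          omega

end Weight

theorem IsRow.add_le_treedepth_biUnion [SuccOrder ι] [IsSuccArchimedean ι] {I : Finset ι}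
    (hI : (I : Set ι).OrdConnected) (h : IsRow G C I) {u b : ℕ}
    (hu : ∀ x ∈ I, u ≤ treedepth (G.induce (C x))) (hb : 2 ^ b ≤ I.card) :
    u + b ≤ treedepth (G.induce (⋃ x ∈ I, C x)) := by
  have hweight := h.sum_treedepth_le (f := fun s => if u ≤ s then 1 else 0)
    (g := fun t => 2 ^ (t + 1 - u) - 1) (fun s t hst => by grind) (fun t => Nat.zero_le _)
    (fun t => ?_) hI le_rfl
  · rw [Finset.sum_congr rfl fun x hx => if_pos (hu x hx), Finset.sum_const, smul_eq_mul,
      mul_one] at hweight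
    have hpow : 2 ^ b < 2 ^ (treedepth (G.induce (⋃ x ∈ I, C x)) + 1 - u) := by
      have := Nat.two_pow_pos (treedepth (G.induce (⋃ x ∈ I, C x)) + 1 - u)
      omega
    have := (Nat.pow_lt_pow_iff_right Nat.one_lt_two).1 hpow
    omega
  · rcases le_or_gt u (t + 1) with hut | hut
    · have := Nat.two_pow_pos (t + 1 - u)
      rw [if_pos hut, Nat.succ_sub hut, pow_succ]
      omega
    · simp [hut.not_ge, show t + 1 - u = 0 by omega]

end Row

/-! ### Treedepth of `T_d(H)` -/

section Copies

variable {W : Type} {d : ℕ} {H : SimpleGraph W}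

/-- The vertex `y` of the copy of `T_d(H)` attached at `x`, as a vertex of `T_{d+1}(H)`. -/
def inCopy (x : W) (y : TVert W d) : TVert W (d + 1) := some (x, y)

theorem eq_handle_or_eq_inCopy (v : TVert W (d + 1)) :
    v = handle W (d + 1) ∨ ∃ x y, v = inCopy x y :=
  match v with
  | none => Or.inl rfl
  | some (x, y) => Or.inr ⟨x, y, rfl⟩

theorem inCopy_inj {x x' : W} {y y' : TVert W d} : inCopy x y = inCopy x' y' ↔ x = x' ∧ y = y' :=
  Option.some_inj.trans Prod.mk_inj

theorem T_adj_handle_inCopy {x : W} {y : TVert W d} :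
    (T (d + 1) H).Adj (handle W (d + 1)) (inCopy x y) ↔ y = handle W d :=
  Iff.rfl

theorem T_adj_inCopy {x x' : W} {y y' : TVert W d} :
    (T (d + 1) H).Adj (inCopy x y) (inCopy x' y') ↔
      x = x' ∧ (T d H).Adj y y' ∨ H.Adj x x' ∧ y = handle W d ∧ y' = handle W d :=
  Iff.rfl

/-- The copy of `T_d(H)` attached at `x` in `T_{d+1}(H)`. -/
def copyEmbedding (H : SimpleGraph W) (d : ℕ) (x : W) : T d H ↪g T (d + 1) H where
  toFun := inCopy x
  inj' _ _ h := (inCopy_inj.1 h).2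
  map_rel_iff' {y y'} := by
    refine T_adj_inCopy.trans ⟨fun h => ?_, fun h => .inl ⟨rfl, h⟩⟩
    exact (h.resolve_right fun h => H.irrefl h.1).2

theorem isRow_inCopy [LinearOrder W] (hH : hasse W ≤ H) {I : Set W} {S : W → Set (TVert W d)}
    (hS : ∀ x ∈ I, ((T d H).induce (S x)).Connected) (hhandle : ∀ x ∈ I, handle W d ∈ S x) :
    IsRow (T (d + 1) H) (fun x => inCopy x '' S x) I where
  connected x hx := connected_induce_image (copyEmbedding H d x).toHom (hS x hx)
  pairwiseDisjoint x _ x' _ hne := by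
    refine Set.disjoint_left.2 ?_
    rintro _ ⟨y, -, rfl⟩ ⟨y', -, h⟩
    exact hne (inCopy_inj.1 h).1.symm
  exists_adj x hx x' hx' hcov :=
    ⟨_, Set.mem_image_of_mem _ (hhandle x hx), _, Set.mem_image_of_mem _ (hhandle x' hx'),
      Or.inr ⟨hH (Or.inl hcov), rfl, rfl⟩⟩

theorem T_reachable_handle : ∀ (d : ℕ) (v : TVert W d), (T d H).Reachable (handle W d) v
  | 0, _ => .refl _
  | d + 1, v => by
    obtain rfl | ⟨x, y, rfl⟩ := eq_handle_or_eq_inCopy v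
    · exact .refl _
    · have hadj : (T (d + 1) H).Adj (handle W (d + 1)) (inCopy x (handle W d)) := rfl
      exact hadj.reachable.trans ((T_reachable_handle d y).map (copyEmbedding H d x).toHom)

theorem connected_T (d : ℕ) (H : SimpleGraph W) : (T d H).Connected :=
  (connected_iff_exists_forall_reachable _).2 ⟨handle W d, T_reachable_handle d⟩

theorem mul_add_one_le_treedepth_T [Fintype W] [LinearOrder W] [SuccOrder W] [IsSuccArchimedean W]
    (hH : hasse W ≤ H) {a : ℕ} (ha : 2 ^ a ≤ Fintype.card W) (d : ℕ) :
    a * d + 1 ≤ treedepth (T d H) := by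
  induction d with
  | zero =>
    have : Nonempty (TVert W 0) := ⟨handle W 0⟩
    simpa using one_le_treedepth (T 0 H)
  | succ d ih =>
    have hcopy (x : W) : a * d + 1 ≤ treedepth ((T (d + 1) H).induce (inCopy x '' Set.univ)) :=
      ih.trans ((treedepth_mono (induceUnivIso _).symm.isContained).trans
        (treedepth_induce_le_image (copyEmbedding H d x).toCopy Set.univ))
    have hrow : IsRow (T (d + 1) H) (fun x => inCopy x '' Set.univ) (Finset.univ : Finset W) :=
      isRow_inCopy hH (fun _ _ => (induceUnivIso _).connected_iff.2 (connected_T d H))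
        fun _ _ => Set.mem_univ _
    calc a * (d + 1) + 1 = a * d + 1 + a := by ring
      _ ≤ treedepth ((T (d + 1) H).induce (⋃ x ∈ (Finset.univ : Finset W), inCopy x '' Set.univ)) :=
          hrow.add_le_treedepth_biUnion (by simp [Set.ordConnected_univ]) (fun x _ => hcopy x) ha
      _ ≤ treedepth (T (d + 1) H) := treedepth_mono (Embedding.induce _).isContained

/-- The component of the handle in `T_d(H) - Y`, for sets `Y` that do not contain the handle. -/
def handleComponent : (d : ℕ) → Set (TVert W d) → Set (TVert W d)
  | 0, _ => {handle W 0}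
  | d + 1, Y => insert (handle W (d + 1)) (⋃ x ∈ {x | inCopy x (handle W d) ∉ Y},
      inCopy x '' handleComponent d (inCopy x ⁻¹' Y))

theorem handle_mem_handleComponent : ∀ (d : ℕ) (Y : Set (TVert W d)),
    handle W d ∈ handleComponent d Y
  | 0, _ => rfl
  | _ + 1, _ => Set.mem_insert _ _

theorem connected_induce_handleComponent (H : SimpleGraph W) : ∀ (d : ℕ) (Y : Set (TVert W d)),
    ((T d H).induce (handleComponent d Y)).Connected
  | 0, _ => by
    rw [handleComponent]
    exact Connected.of_subsingleton
  | d + 1, Y => by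
    refine induce_connected_of_patches _ (handle_mem_handleComponent (d + 1) Y) fun {v} hv => ?_
    obtain rfl | hv := hv
    · exact ⟨_, subset_rfl, handle_mem_handleComponent _ Y, handle_mem_handleComponent _ Y, .refl _⟩
    · obtain ⟨x, hx, hvx⟩ := Set.mem_iUnion₂.1 hv
      have hpatch := connected_induce_union (G := T (d + 1) H) (s := {handle W (d + 1)})
        .of_subsingleton (connected_induce_image (copyEmbedding H d x).toHom
          (connected_induce_handleComponent H d (inCopy x ⁻¹' Y))).preconnected
        (Set.mem_singleton _) (Set.mem_image_of_mem _ (handle_mem_handleComponent d _)) rfl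
      exact ⟨_, Set.insert_subset_insert (Set.subset_biUnion_of_mem hx), .inl rfl, .inr hvx,
        hpatch.preconnected _ _⟩

theorem disjoint_handleComponent : ∀ (d : ℕ) (Y : Set (TVert W d)), handle W d ∉ Y →
    Disjoint (handleComponent d Y) Y
  | 0, _, h => Set.disjoint_singleton_left.2 h
  | d + 1, Y, h => by
    refine Set.disjoint_insert_left.2 ⟨h, Set.disjoint_iUnion₂_left.2 fun x hx => ?_⟩
    exact Set.disjoint_image_left.2 (disjoint_handleComponent d _ hx)

end Copies

/-! ### Lower bounds on rates of fragility -/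

section LevelWeight

variable {W : Type} [Fintype W] {k d : ℕ}

/-- The weight on the vertices of `T_d(H)` that spreads total weight `1` uniformly over each of the
levels `0, …, k`, where the handle is at level `0` and the copies attached to `H` start one level
further down. -/
noncomputable def levelWeight : (k d : ℕ) → TVert W d → ℝ
  | _, 0, _ => 1
  | _, _ + 1, none => 1
  | 0, _ + 1, some _ => 0
  | k + 1, d + 1, some (_, y) => levelWeight k d y / Fintype.card W

theorem levelWeight_nonneg : ∀ (k d : ℕ) (v : TVert W d), 0 ≤ levelWeight k d v
  | 0, 0, _ => zero_le_one
  | _ + 1, 0, _ => zero_le_one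
  | 0, _ + 1, none => zero_le_one
  | _ + 1, _ + 1, none => zero_le_one
  | 0, _ + 1, some _ => le_rfl
  | k + 1, d + 1, some (_, y) => div_nonneg (levelWeight_nonneg k d y) (Nat.cast_nonneg _)

theorem levelWeight_handle : ∀ k d : ℕ, levelWeight k d (handle W d) = 1
  | 0, 0 => rfl
  | _ + 1, 0 => rfl
  | 0, _ + 1 => rfl
  | _ + 1, _ + 1 => rfl

theorem levelWeight_zero_inCopy (x : W) (y : TVert W d) :
    levelWeight 0 (d + 1) (inCopy x y) = 0 :=
  rfl

theorem levelWeight_succ_inCopy (x : W) (y : TVert W d) :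
    levelWeight (k + 1) (d + 1) (inCopy x y) = levelWeight k d y / Fintype.card W :=
  rfl

theorem sum_TVert_zero (f : TVert W 0 → ℝ) : ∑ v, f v = f (handle W 0) :=
  Fintype.sum_unique (ι := Unit) f

theorem sum_TVert_succ (f : TVert W (d + 1) → ℝ) :
    ∑ v, f v = f (handle W (d + 1)) + ∑ x, ∑ y, f (inCopy x y) := by
  rw [← Fintype.sum_prod_type' (f := fun x y => f (inCopy x y))]
  exact Fintype.sum_option (α := W × TVert W d) f

theorem sum_levelWeight_le : ∀ k d : ℕ, ∑ v : TVert W d, levelWeight k d v ≤ k + 1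
  | k, 0 => by simp [sum_TVert_zero, levelWeight_handle]
  | 0, d + 1 => by simp [sum_TVert_succ, levelWeight_handle, levelWeight_zero_inCopy]
  | k + 1, d + 1 => by
    simp only [sum_TVert_succ, levelWeight_handle, levelWeight_succ_inCopy, ← Finset.sum_div,
      Finset.sum_const, Finset.card_univ, nsmul_eq_mul]
    rcases (Nat.cast_nonneg (α := ℝ) (Fintype.card W)).eq_or_lt' with hW | hW
    · simpa [hW] using add_nonneg k.cast_nonneg zero_le_one
    · rw [mul_div_cancel_left₀ _ hW.ne']
      push_cast
      linarith [sum_levelWeight_le k d]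

/-- The total weight of the vertices in `Y` under `levelWeight k d`. -/
noncomputable def levelMass (k d : ℕ) (Y : Set (TVert W d)) : ℝ :=
  ∑ v, Y.indicator (levelWeight k d) v

theorem levelMass_nonneg (k d : ℕ) (Y : Set (TVert W d)) : 0 ≤ levelMass k d Y :=
  Finset.sum_nonneg fun _ _ => Set.indicator_nonneg (fun v _ => levelWeight_nonneg k d v) _

theorem one_le_levelMass {Y : Set (TVert W d)} (h : handle W d ∈ Y) : 1 ≤ levelMass k d Y := by
  rw [← levelWeight_handle (W := W) k d, ← Set.indicator_of_mem h (levelWeight k d)]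
  exact Finset.single_le_sum (f := Y.indicator (levelWeight k d))
    (fun _ _ => Set.indicator_nonneg (fun v _ => levelWeight_nonneg k d v) _) (Finset.mem_univ _)

theorem levelMass_succ {Y : Set (TVert W (d + 1))} (h : handle W (d + 1) ∉ Y) :
    levelMass (k + 1) (d + 1) Y = (∑ x, levelMass k d (inCopy x ⁻¹' Y)) / Fintype.card W := by
  have hcopy (x : W) (y : TVert W d) : Y.indicator (levelWeight (k + 1) (d + 1)) (inCopy x y) =
      (inCopy x ⁻¹' Y).indicator (levelWeight k d) y / Fintype.card W := by
    classical
    simp only [Set.indicator_apply, Set.mem_preimage, levelWeight_succ_inCopy, ite_div, zero_div]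
  simp only [levelMass, sum_TVert_succ, Set.indicator_of_notMem h, zero_add, hcopy, Finset.sum_div]

end LevelWeight

theorem IsRow.sum_exp_treedepth_sdiff_le {V ι : Type*} [Finite V] [LinearOrder ι] [SuccOrder ι]
    [IsSuccArchimedean ι] {G : SimpleGraph V} {C : ι → Set V} {I : Finset ι} (D : Finset ι)
    (hI : (I : Set ι).OrdConnected) (h : IsRow G C (I \ D : Finset ι)) :
    ∑ x ∈ I \ D, Real.exp (treedepth (G.induce (C x))) ≤
      ((I ∩ D).card + 1) * (4 * Real.exp (treedepth (G.induce (⋃ x ∈ I \ D, C x)))) := by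
  have hexp (t : ℕ) : 4 * Real.exp t + 4 * Real.exp t + Real.exp (t + 1 : ℕ) ≤
      4 * Real.exp (t + 1 : ℕ) := by
    push_cast
    rw [Real.exp_add]
    nlinarith [Real.exp_one_gt_d9, Real.exp_pos t]
  have hmono : Monotone fun t : ℕ => Real.exp t := Real.exp_monotone.comp Nat.mono_cast
  have hsum := h.sum_treedepth_sdiff_le hmono (fun t => by positivity) hexp D hI le_rfl
  rwa [nsmul_eq_mul, Nat.cast_succ] at hsum

theorem sum_one_add_log_add_sub_le {ι : Type*} [Fintype ι] [DecidableEq ι] {D : Finset ι} {s t : ℝ}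
    {u : ι → ℝ} (hs : 0 < s)
    (hgood : ∑ x ∈ Dᶜ, Real.exp (u x) ≤ (D.card + 1) * (4 * Real.exp t))
    (hbad : ∀ x ∈ D, 1 + Real.log s + u x - t ≤ -(4 * s)) :
    ∑ x, (1 + Real.log s + u x - t) ≤ 4 * s := by
  have hle (x : ι) : 1 + Real.log s + u x - t ≤ s * Real.exp (-t) * Real.exp (u x) := by
    have h := Real.add_one_le_exp (Real.log s + -t + u x)
    rw [Real.exp_add, Real.exp_add, Real.exp_log hs] at h
    linarith
  calc ∑ x, (1 + Real.log s + u x - t)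
      = ∑ x ∈ D, (1 + Real.log s + u x - t) + ∑ x ∈ Dᶜ, (1 + Real.log s + u x - t) :=
        (Finset.sum_add_sum_compl D _).symm
    _ ≤ ∑ x ∈ D, -(4 * s) + ∑ x ∈ Dᶜ, s * Real.exp (-t) * Real.exp (u x) :=
        add_le_add (Finset.sum_le_sum hbad) (Finset.sum_le_sum fun x _ => hle x)
    _ ≤ ∑ x ∈ D, -(4 * s) + s * Real.exp (-t) * ((D.card + 1) * (4 * Real.exp t)) := by
        rw [← Finset.mul_sum]
        gcongr
    _ = 4 * s := by
        rw [Finset.sum_const, nsmul_eq_mul, Real.exp_neg]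
        field_simp
        ring

section Fragility

variable {W : Type} [Fintype W] [LinearOrder W] [SuccOrder W] [IsSuccArchimedean W]
  {H : SimpleGraph W} {k d : ℕ} {s K : ℝ}

theorem sum_exp_treedepth_handleComponent_le (hH : hasse W ≤ H) {Y : Set (TVert W (d + 1))}
    {D : Finset W} (hD : ∀ x, x ∈ D ↔ inCopy x (handle W d) ∈ Y) :
    ∑ x ∈ Dᶜ, Real.exp (treedepth ((T d H).induce (handleComponent d (inCopy x ⁻¹' Y)))) ≤
      (D.card + 1) *
        (4 * Real.exp (treedepth ((T (d + 1) H).induce (handleComponent (d + 1) Y)))) := by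
  set S : W → Set (TVert W d) := fun x => handleComponent d (inCopy x ⁻¹' Y)
  have hrow : IsRow (T (d + 1) H) (fun x => inCopy x '' S x) (Finset.univ \ D : Finset W) :=
    isRow_inCopy hH (fun _ _ => connected_induce_handleComponent H d _)
      fun _ _ => handle_mem_handleComponent d _
  have hsub : ⋃ x ∈ Dᶜ, inCopy x '' S x ⊆ handleComponent (d + 1) Y := by
    refine (Set.biUnion_mono (fun x hx => ?_) fun _ _ => subset_rfl).trans (Set.subset_insert _ _)
    exact fun hxY => Finset.mem_compl.1 hx ((hD x).2 hxY)
  calc ∑ x ∈ Dᶜ, Real.exp (treedepth ((T d H).induce (S x)))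
      ≤ ∑ x ∈ Dᶜ, Real.exp (treedepth ((T (d + 1) H).induce (inCopy x '' S x))) := by
        gcongr with x
        exact treedepth_induce_le_image (copyEmbedding H d x).toCopy (S x)
    _ ≤ (D.card + 1) * (4 * Real.exp (treedepth ((T (d + 1) H).induce
          (⋃ x ∈ Dᶜ, inCopy x '' S x)))) := by
        simpa only [← Finset.compl_eq_univ_sdiff, Finset.univ_inter] using
          hrow.sum_exp_treedepth_sdiff_le D (by simp [Set.ordConnected_univ])
    _ ≤ (D.card + 1) * (4 * Real.exp (treedepth ((T (d + 1) H).induce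
          (handleComponent (d + 1) Y)))) := by
        gcongr
        exact treedepth_induce_mono _ hsub

variable [Nonempty W]

theorem one_add_log_add_average_le_treedepth_handleComponent_add (hH : hasse W ≤ H) (hs : 0 < s)
    {Y : Set (TVert W (d + 1))} {u : W → ℝ}
    (hgood : ∀ x, inCopy x (handle W d) ∉ Y →
      u x ≤ treedepth ((T d H).induce (handleComponent d (inCopy x ⁻¹' Y))))
    (hbad : ∀ x, inCopy x (handle W d) ∈ Y → 1 + Real.log s + u x ≤ -(4 * s)) :
    1 + Real.log s + (∑ x, u x) / Fintype.card W ≤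
      treedepth ((T (d + 1) H).induce (handleComponent (d + 1) Y)) + 4 * s / Fintype.card W := by
  classical
  have hn : (0 : ℝ) < Fintype.card W := by exact_mod_cast Fintype.card_pos
  set t : ℝ := ((treedepth ((T (d + 1) H).induce (handleComponent (d + 1) Y)) : ℕ) : ℝ)
  let D : Finset W := {x | inCopy x (handle W d) ∈ Y}
  have hD (x : W) : x ∈ D ↔ inCopy x (handle W d) ∈ Y := Finset.mem_filter_univ x
  have hexp : ∑ x ∈ Dᶜ, Real.exp (u x) ≤ (D.card + 1) * (4 * Real.exp t) := by
    refine le_trans ?_ (sum_exp_treedepth_handleComponent_le hH hD)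
    gcongr with x hx
    exact hgood x (mt (hD x).2 (Finset.mem_compl.1 hx))
  have havg := sum_one_add_log_add_sub_le hs hexp fun x hx => by
    linarith [hbad x ((hD x).1 hx), show 0 ≤ t from Nat.cast_nonneg _]
  have hsum : ∑ x, (1 + Real.log s + u x - t) =
      Fintype.card W * (1 + Real.log s + (∑ x, u x) / Fintype.card W - t) := by
    simp only [Finset.sum_add_distrib, Finset.sum_sub_distrib, Finset.sum_const, Finset.card_univ,
      nsmul_eq_mul]
    field_simp
  rw [hsum, ← le_div_iff₀' hn] at havg
  linarith

theorem mul_le_treedepth_handleComponent_add (hH : hasse W ≤ H) (hs : 1 ≤ s) (hkd : k ≤ d)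
    (hK : (k + 1) * (1 + Real.log s) + 4 * s ≤ K) {Y : Set (TVert W d)} (hY : handle W d ∉ Y) :
    k * (1 + Real.log s) ≤ treedepth ((T d H).induce (handleComponent d Y)) +
      K * levelMass k d Y + k * (4 * s / Fintype.card W) := by
  have hlog := Real.log_nonneg hs
  have hK0 : 0 ≤ K := le_trans (by positivity) hK
  induction k generalizing d with
  | zero =>
    have := levelMass_nonneg 0 d Y
    push_cast
    rw [zero_mul]
    positivity
  | succ k ih =>
    obtain ⟨d, rfl⟩ : ∃ d', d = d' + 1 := ⟨d - 1, by omega⟩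
    push_cast at hK ⊢
    have hK' : (k + 1) * (1 + Real.log s) + 4 * s ≤ K := by linarith
    set e : ℝ := k * (4 * s / Fintype.card W)
    let u : W → ℝ := fun x => k * (1 + Real.log s) - e - K * levelMass k d (inCopy x ⁻¹' Y)
    have hsum : (∑ x, u x) / Fintype.card W =
        k * (1 + Real.log s) - e - K * levelMass (k + 1) (d + 1) Y := by
      simp only [u, levelMass_succ hY, Finset.sum_sub_distrib, ← Finset.mul_sum, Finset.sum_const,
        Finset.card_univ, nsmul_eq_mul]
      field_simp
    have hstep := one_add_log_add_average_le_treedepth_handleComponent_add (s := s) (u := u)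
      (Y := Y) hH (by linarith)
      (fun x hx => by
        have hxY : handle W d ∉ inCopy x ⁻¹' Y := hx
        linarith [ih (Nat.le_of_succ_le_succ hkd) hK' hxY])
      fun x hx => by
        have : K ≤ K * levelMass k d (inCopy x ⁻¹' Y) :=
          le_mul_of_one_le_right hK0 (one_le_levelMass hx)
        have : 0 ≤ e := by positivity
        linarith
    rw [hsum] at hstep
    linarith

theorem mul_le_treedepth_induce_compl_add (hH : hasse W ≤ H) (hs : 1 ≤ s) (hkd : k ≤ d)
    (hK : (k + 1) * (1 + Real.log s) + 4 * s ≤ K) (Y : Set (TVert W d)) :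
    k * (1 + Real.log s) ≤ treedepth ((T d H).induce Yᶜ) + K * levelMass k d Y +
      k * (4 * s / Fintype.card W) := by
  by_cases hY : handle W d ∈ Y
  · have hlog := Real.log_nonneg hs
    have hK0 : 0 ≤ K := le_trans (by positivity) hK
    have hmass : K ≤ K * levelMass k d Y := le_mul_of_one_le_right hK0 (one_le_levelMass hY)
    have : 0 ≤ treedepth ((T d H).induce Yᶜ) + k * (4 * s / Fintype.card W) := by positivity
    linarith
  · refine (mul_le_treedepth_handleComponent_add hH hs hkd hK hY).trans ?_
    gcongr
    exact treedepth_induce_mono _ (disjoint_handleComponent d Y hY).subset_compl_right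

end Fragility

theorem FractionallyFragile.le_rate_add {f : (V : Type) → SimpleGraph V → ℝ} {r : ℕ → ℝ≥0}
    {V : Type} [Fintype V] {G : SimpleGraph V} (h : FractionallyFragile f r G) {w : V → ℝ}
    (hw : ∀ v, 0 ≤ w v) {A : ℝ}
    (hA : ∀ Y : Finset V, A ≤ f {v // v ∉ Y} (G.induce {v | v ∉ Y}) + ∑ v ∈ Y, w v) {a : ℕ}
    (ha : 1 ≤ a) : A ≤ r a + 1 / a * ∑ v, w v := by
  classical
  obtain ⟨μ, ⟨hμ0, hμ1⟩, hthin, hsupp⟩ := h a ha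
  have hexpect (Y : Finset V) : μ Y * A ≤ μ Y * (r a + ∑ v ∈ Y, w v) := by
    by_cases hY : μ Y = 0
    · simp [hY]
    · have : f _ _ ≤ (r a : ℝ) := hsupp Y hY
      exact mul_le_mul_of_nonneg_left ((hA Y).trans (by gcongr)) (hμ0 Y)
  have hswap : ∑ Y, μ Y * ∑ v ∈ Y, w v = ∑ v, w v * ∑ Y : Finset V with v ∈ Y, μ Y := by
    simp only [Finset.mul_sum]
    rw [Finset.sum_comm' (t' := Finset.univ) (s' := fun v => {Y | v ∈ Y}) (by simp)]
    simp only [mul_comm]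
  calc A = ∑ Y, μ Y * A := by rw [← Finset.sum_mul, hμ1, one_mul]
    _ ≤ ∑ Y, μ Y * (r a + ∑ v ∈ Y, w v) := Finset.sum_le_sum fun Y _ => hexpect Y
    _ = r a + ∑ v, w v * ∑ Y : Finset V with v ∈ Y, μ Y := by
        simp only [mul_add, Finset.sum_add_distrib, ← Finset.sum_mul, hμ1, one_mul, hswap]
    _ ≤ r a + ∑ v, w v * (1 / a) := by
        gcongr with v
        · exact hw v
        · convert hthin v
    _ = r a + 1 / a * ∑ v, w v := by rw [← Finset.sum_mul, mul_comm]

section Rate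

variable {W : Type} [Fintype W] [Nonempty W] [LinearOrder W] [SuccOrder W] [IsSuccArchimedean W]
  {H : SimpleGraph W} {a d : ℕ} {r : ℕ → ℝ≥0}

theorem FractionallyFragile.mul_le_rate_add (hH : hasse W ≤ H)
    (h : FractionallyFragile td r (T d H)) (ha : 1 ≤ a) {k : ℕ} (hkd : k ≤ d) {s : ℝ}
    (hs : 1 ≤ s) :
    k * (1 + Real.log s) ≤ r a + 1 / a * (((k + 1) * (1 + Real.log s) + 4 * s) * (k + 1)) +
      k * (4 * s / Fintype.card W) := by
  set K := (k + 1) * (1 + Real.log s) + 4 * s with hK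
  have hlog := Real.log_nonneg hs
  have hK0 : 0 ≤ K := by positivity
  have hdel (Y : Finset (TVert W d)) :
      k * (1 + Real.log s) - k * (4 * s / Fintype.card W) ≤
        td {v // v ∉ Y} ((T d H).induce {v | v ∉ Y}) + ∑ v ∈ Y, K * levelWeight k d v := by
    have hY := mul_le_treedepth_induce_compl_add hH hs hkd hK.ge (Y : Set (TVert W d))
    rw [levelMass, Finset.sum_indicator_subset _ (Finset.subset_univ Y), Finset.mul_sum] at hY
    exact sub_le_iff_le_add.2 hY
  have hrate := h.le_rate_add (fun v => mul_nonneg hK0 (levelWeight_nonneg k d v)) hdel ha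
  have hmass : ∑ v : TVert W d, K * levelWeight k d v ≤ K * (k + 1) := by
    rw [← Finset.mul_sum]
    exact mul_le_mul_of_nonneg_left (sum_levelWeight_le k d) hK0
  have : 1 / (a : ℝ) * ∑ v : TVert W d, K * levelWeight k d v ≤ 1 / a * (K * (k + 1)) := by gcongr
  linarith

theorem FractionallyFragile.mul_log_div_le (hH : hasse W ≤ H)
    (h : FractionallyFragile td r (T d H)) (ha : 32 ≤ a) (had : a ≤ d)
    (hW : a ≤ Fintype.card W) : a / 8 * Real.log (a / 16) ≤ r a := by
  -- On about `a / 4` levels, deletion with probability `1 / a` costs a quarter of the gain.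
  obtain ⟨k, hk⟩ : ∃ k, a / 4 = k + 1 := ⟨a / 4 - 1, by omega⟩
  have hkle : 4 * ((k : ℝ) + 1) ≤ a := by exact_mod_cast (by omega : 4 * (k + 1) ≤ a)
  have hkge : (a : ℝ) ≤ 4 * (k + 1) + 3 := by exact_mod_cast (by omega : a ≤ 4 * (k + 1) + 3)
  have haR : (32 : ℝ) ≤ a := by exact_mod_cast ha
  have hWR : (a : ℝ) ≤ Fintype.card W := by exact_mod_cast hW
  have hlog : 0 ≤ Real.log (a / 16) := Real.log_nonneg (by linarith)
  have hrate := h.mul_le_rate_add hH (show 1 ≤ a by omega) (show k ≤ d by omega)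
    (show (1 : ℝ) ≤ a / 16 by linarith)
  set l := 1 + Real.log (a / 16)
  have hdeleted : 1 / (a : ℝ) * (((k + 1) * l + 4 * (a / 16)) * (k + 1)) ≤
      ((k + 1) * l + 4 * (a / 16)) / 4 := by
    rw [one_div, inv_mul_le_iff₀ (by linarith)]
    have : 0 ≤ (k + 1) * l + 4 * ((a : ℝ) / 16) := by positivity
    nlinarith
  have hsplit : k * (4 * ((a : ℝ) / 16) / Fintype.card W) ≤ k / 4 := by
    have : 4 * ((a : ℝ) / 16) / Fintype.card W ≤ 1 / 4 := by
      rw [div_le_iff₀ (by linarith)]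
      linarith
    nlinarith
  have hlevels : a / 8 * l ≤ (k - (k + 1) / 4) * l :=
    mul_le_mul_of_nonneg_right (by linarith) (by positivity)
  linarith

theorem FractionallyFragile.mul_log_le (hH : hasse W ≤ H)
    (h : FractionallyFragile td r (T d H)) (ha : 256 ≤ a) (had : a ≤ d)
    (hW : a ≤ Fintype.card W) : 1 / 16 * (a * Real.log a) ≤ r a := by
  have haR : (256 : ℝ) ≤ a := by exact_mod_cast ha
  have hlog : Real.log a ≤ 2 * Real.log (a / 16) :=
    calc Real.log a ≤ Real.log ((a / 16) ^ 2) := Real.log_le_log (by linarith) (by nlinarith)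
      _ = 2 * Real.log (a / 16) := by rw [Real.log_pow, Nat.cast_ofNat]
  have hrate := h.mul_log_div_le hH (by omega) had hW
  nlinarith

end Rate

/-! ### Drawings with the vertices on a parabola -/

theorem convex_parabola_epigraph : Convex ℝ {p : ℝ × ℝ | p.1 ^ 2 ≤ p.2} := by
  simpa using (even_two.convexOn_pow (𝕜 := ℝ)).convex_epigraph

theorem mem_parabola_chord {a b : ℝ} (hab : a ≤ b) {p : ℝ × ℝ}
    (hp : p ∈ segment ℝ (a, a ^ 2) (b, b ^ 2)) :
    a ≤ p.1 ∧ p.1 ≤ b ∧ p.2 = (a + b) * p.1 - a * b := by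
  obtain ⟨s, t, hs, ht, hst, rfl⟩ := hp
  obtain rfl : s = 1 - t := by linarith
  simp only [Prod.smul_mk, Prod.mk_add_mk, smul_eq_mul]
  exact ⟨by nlinarith, by nlinarith, by ring⟩

theorem eq_of_mem_parabola_chord {a b : ℝ} (hab : a ≤ b) {p : ℝ × ℝ}
    (hp : p ∈ segment ℝ (a, a ^ 2) (b, b ^ 2)) (hpar : p.2 = p.1 ^ 2) : p.1 = a ∨ p.1 = b := by
  obtain ⟨-, -, hline⟩ := mem_parabola_chord hab hp
  have : (p.1 - a) * (p.1 - b) = 0 := by linear_combination hline - hpar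
  simpa only [mul_eq_zero, sub_eq_zero] using this

theorem lt_of_mem_parabola_chord {a b : ℝ} (hab : a ≤ b) {p : ℝ × ℝ}
    (hp : p ∈ segment ℝ (a, a ^ 2) (b, b ^ 2)) (hpar : p.2 ≠ p.1 ^ 2) : a < p.1 ∧ p.1 < b := by
  obtain ⟨ha, hb, hline⟩ := mem_parabola_chord hab hp
  refine ⟨ha.lt_of_ne' ?_, hb.lt_of_ne ?_⟩ <;> intro h <;> exact hpar (by rw [hline, h]; ring)

theorem le_of_mem_parabola_chords {a b a' b' : ℝ} (hab : a ≤ b) (hab' : a' ≤ b')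
    (hcross : a < a' → a' < b → ¬ b < b') {p : ℝ × ℝ}
    (hp : p ∈ segment ℝ (a, a ^ 2) (b, b ^ 2)) (hp' : p ∈ segment ℝ (a', a' ^ 2) (b', b' ^ 2))
    (hpar : p.2 ≠ p.1 ^ 2) : a' ≤ a := by
  obtain ⟨-, -, hline⟩ := mem_parabola_chord hab hp
  obtain ⟨-, -, hline'⟩ := mem_parabola_chord hab' hp'
  obtain ⟨-, hb⟩ := lt_of_mem_parabola_chord hab hp hpar
  obtain ⟨ha', -⟩ := lt_of_mem_parabola_chord hab' hp' hpar
  by_contra! h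
  have hbb : b' ≤ b := not_lt.1 (hcross h (ha'.trans hb))
  nlinarith [mul_pos (sub_pos.2 h) (sub_pos.2 hb), mul_nonneg (sub_nonneg.2 hbb) (sub_pos.2 ha').le]

theorem eq_of_mem_parabola_chords {a b a' b' : ℝ} (hab : a ≤ b) (hab' : a' ≤ b')
    (hcross : a < a' → a' < b → ¬ b < b') (hcross' : a' < a → a < b' → ¬ b' < b) {p : ℝ × ℝ}
    (hp : p ∈ segment ℝ (a, a ^ 2) (b, b ^ 2)) (hp' : p ∈ segment ℝ (a', a' ^ 2) (b', b' ^ 2))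
    (hpar : p.2 ≠ p.1 ^ 2) : a = a' ∧ b = b' := by
  obtain rfl : a = a' := le_antisymm (le_of_mem_parabola_chords hab' hab hcross' hp' hp hpar)
    (le_of_mem_parabola_chords hab hab' hcross hp hp' hpar)
  obtain ⟨-, -, hline⟩ := mem_parabola_chord hab hp
  obtain ⟨-, -, hline'⟩ := mem_parabola_chord hab' hp'
  obtain ⟨ha, -⟩ := lt_of_mem_parabola_chord hab hp hpar
  exact ⟨rfl, mul_left_cancel₀ (sub_ne_zero.2 ha.ne') (by linear_combination hline' - hline)⟩

theorem isPreconnected_below_parabola : IsPreconnected {p : ℝ × ℝ | p.2 < p.1 ^ 2} := by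
  have himage : (fun p : ℝ × ℝ => (p.1, p.1 ^ 2 - p.2)) '' (Set.univ ×ˢ Set.Ioi 0) =
      {p : ℝ × ℝ | p.2 < p.1 ^ 2} := by
    ext ⟨x, y⟩
    refine ⟨?_, fun h => ⟨(x, x ^ 2 - y), ⟨trivial, Set.mem_Ioi.2 (sub_pos.2 h)⟩, by simp⟩⟩
    rintro ⟨⟨x', s⟩, ⟨-, hs⟩, h⟩
    obtain ⟨rfl, rfl⟩ := Prod.mk_inj.1 h
    exact sub_lt_self _ (Set.mem_Ioi.1 hs)
  rw [← himage]
  exact (isPreconnected_univ.prod isPreconnected_Ioi).image _ (by fun_prop)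

theorem not_isBounded_below_parabola : ¬ Bornology.IsBounded {p : ℝ × ℝ | p.2 < p.1 ^ 2} := by
  intro h
  have hsub : Set.Iio (0 : ℝ) ⊆ Prod.snd '' {p : ℝ × ℝ | p.2 < p.1 ^ 2} :=
    fun y hy => ⟨(0, y), by simpa using hy, rfl⟩
  exact not_bddBelow_Iio (0 : ℝ) (h.image_snd.subset hsub).bddBelow

theorem mem_closure_below_parabola (x : ℝ) : (x, x ^ 2) ∈ closure {p : ℝ × ℝ | p.2 < p.1 ^ 2} := by
  have hcont : Continuous fun y : ℝ => (x, y) := by fun_prop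
  have hmem : x ^ 2 ∈ closure (Set.Iio (x ^ 2)) := by simp
  exact map_mem_closure hcont hmem fun y hy => hy

theorem isArc_segment {p q : ℝ × ℝ} (h : p ≠ q) : IsArc (segment ℝ p q) p q :=
  ⟨Path.segment p q, fun _ _ hst => Subtype.ext (AffineMap.lineMap_injective ℝ h hst),
    Path.range_segment p q⟩

section Noncrossing

variable {V : Type*} {G : SimpleGraph V}

/-- No two edges of `G` have interleaving ends when the vertices are placed on a line according
to `f`. -/
def IsNoncrossing {α : Type*} [LT α] (G : SimpleGraph V) (f : V → α) : Prop :=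
  ∀ ⦃u v u' v'⦄, G.Adj u v → G.Adj u' v' → f u < f u' → f u' < f v → ¬ f v < f v'

theorem IsNoncrossing.comp_strictMono {α β : Type*} [LinearOrder α] [Preorder β] {f : V → α}
    {φ : α → β} (hG : IsNoncrossing G f) (hφ : StrictMono φ) : IsNoncrossing G (φ ∘ f) := by
  intro u v u' v' h h'
  simpa only [Function.comp_apply, hφ.lt_iff_lt] using hG h h'

theorem exists_adj_lt_of_mem_edgeSet {α : Type*} [LinearOrder α] {f : V → α}
    (hf : Function.Injective f) {e : Sym2 V} (he : e ∈ G.edgeSet) :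
    ∃ u v, G.Adj u v ∧ f u < f v ∧ e = s(u, v) := by
  induction e with
  | _ u v =>
    have huv : G.Adj u v := he
    rcases (hf.ne huv.ne).lt_or_gt with h | h
    · exact ⟨u, v, huv, h, rfl⟩
    · exact ⟨v, u, huv.symm, h, Sym2.eq_swap⟩

theorem convexHull_image_sym2 {E : Type*} [AddCommGroup E] [Module ℝ E] (p : V → E) (u v : V) :
    convexHull ℝ (p '' {w | w ∈ s(u, v)}) = segment ℝ (p u) (p v) := by
  have : {w | w ∈ s(u, v)} = {u, v} := Set.ext fun w => Sym2.mem_iff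
  rw [this, Set.image_pair, convexHull_pair]

/-- The straight-line drawing of `G` with the vertices on the parabola `y = x ^ 2`. -/
def parabolaDrawing (f : V → ℝ) (hf : Function.Injective f) (hG : IsNoncrossing G f) :
    PlaneDrawing G where
  point v := (f v, f v ^ 2)
  arc e := convexHull ℝ ((fun v => (f v, f v ^ 2)) '' {w | w ∈ e})
  point_injective u v h := hf (Prod.mk_inj.1 h).1
  isArc u v huv := by
    rw [convexHull_image_sym2]
    exact isArc_segment fun h => huv.ne (hf (Prod.mk_inj.1 h).1)
  mem_of_point_mem_arc e he w hw := by
    obtain ⟨u, v, -, huv, rfl⟩ := exists_adj_lt_of_mem_edgeSet hf he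
    rw [convexHull_image_sym2] at hw
    exact Sym2.mem_iff.2 ((eq_of_mem_parabola_chord huv.le hw rfl).imp (@hf _ _) (@hf _ _))
  arc_inter_arc := by
    rintro e he e' he' hne p ⟨hp, hp'⟩
    obtain ⟨u, v, huv, hlt, rfl⟩ := exists_adj_lt_of_mem_edgeSet hf he
    obtain ⟨u', v', huv', hlt', rfl⟩ := exists_adj_lt_of_mem_edgeSet hf he'
    rw [convexHull_image_sym2] at hp hp'
    by_cases hpar : p.2 = p.1 ^ 2
    · rcases eq_of_mem_parabola_chord hlt.le hp hpar with h | h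
      · exact ⟨u, Prod.ext h.symm (by rw [hpar, h])⟩
      · exact ⟨v, Prod.ext h.symm (by rw [hpar, h])⟩
    · obtain ⟨hu, hv⟩ := eq_of_mem_parabola_chords hlt.le hlt'.le (hG huv huv') (hG huv' huv)
        hp hp' hpar
      exact absurd (by rw [hf hu, hf hv]) hne

theorem support_parabolaDrawing_subset {f : V → ℝ} (hf : Function.Injective f)
    (hG : IsNoncrossing G f) :
    (parabolaDrawing f hf hG).support ⊆ {p : ℝ × ℝ | p.1 ^ 2 ≤ p.2} := by
  have hpoint (w : V) : (f w, f w ^ 2) ∈ {p : ℝ × ℝ | p.1 ^ 2 ≤ p.2} := le_refl (f w ^ 2)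
  refine Set.union_subset (Set.range_subset_iff.2 hpoint) (Set.iUnion₂_subset fun e _ => ?_)
  exact convexHull_min (Set.image_subset_iff.2 fun w _ => hpoint w) convex_parabola_epigraph

theorem isOuterplanar_of_isNoncrossing {f : V → ℝ} (hf : Function.Injective f)
    (hG : IsNoncrossing G f) : IsOuterplanar G := by
  refine ⟨parabolaDrawing f hf hG, fun v => ?_⟩
  have hbelow : {p : ℝ × ℝ | p.2 < p.1 ^ 2} ⊆ (parabolaDrawing f hf hG).supportᶜ :=
    fun p (hp : p.2 < p.1 ^ 2) hp' => hp.not_ge (support_parabolaDrawing_subset hf hG hp')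
  have houter : {p : ℝ × ℝ | p.2 < p.1 ^ 2} ⊆ outerFace (parabolaDrawing f hf hG).support :=
    fun p hp => ⟨hbelow hp, fun hb => not_isBounded_below_parabola (hb.subset
      (isPreconnected_below_parabola.subset_connectedComponentIn hp hbelow))⟩
  exact closure_mono houter (mem_closure_below_parabola (f v))

end Noncrossing

/-! ### Outerplanarity of `T_d(P_n)` -/

theorem exists_adj_of_T_adj_inCopy {W : Type} {d : ℕ} {H : SimpleGraph W} {u : TVert W (d + 1)}
    {x : W} {y : TVert W d} (h : (T (d + 1) H).Adj u (inCopy x y)) (hy : y ≠ handle W d) :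
    ∃ y', u = inCopy x y' ∧ (T d H).Adj y' y := by
  obtain rfl | ⟨x', y', rfl⟩ := eq_handle_or_eq_inCopy u
  · exact absurd (T_adj_handle_inCopy.1 h) hy
  · obtain ⟨rfl, hadj⟩ := (T_adj_inCopy.1 h).resolve_right fun h => hy h.2.2
    exact ⟨y', rfl, hadj⟩

section Position

variable {n d : ℕ}

/-- The position of a vertex of `T_d(P_n)` in the enumeration of its vertices where the handle
comes first, followed by the vertices of the copies of `T_{d-1}(P_n)`, copy by copy. -/
def position : (d : ℕ) → TVert (Fin n) d → ℕ
  | 0, _ => 0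
  | _ + 1, none => 0
  | d + 1, some (x, y) => x * Fintype.card (TVert (Fin n) d) + position d y + 1

theorem position_handle : ∀ d : ℕ, position d (handle (Fin n) d) = 0
  | 0 => rfl
  | _ + 1 => rfl

theorem position_inCopy (x : Fin n) (y : TVert (Fin n) d) :
    position (d + 1) (inCopy x y) = x * Fintype.card (TVert (Fin n) d) + position d y + 1 :=
  rfl

theorem ne_handle_of_position_lt {v v' : TVert (Fin n) d} (h : position d v < position d v') :
    v' ≠ handle (Fin n) d := by
  rintro rfl
  exact Nat.not_lt_zero _ (h.trans_eq (position_handle d))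

theorem card_TVert_succ (W : Type) [Fintype W] (d : ℕ) :
    Fintype.card (TVert W (d + 1)) = Fintype.card W * Fintype.card (TVert W d) + 1 :=
  (Fintype.card_option (α := W × TVert W d)).trans (by rw [Fintype.card_prod])

theorem position_lt_card : ∀ (d : ℕ) (v : TVert (Fin n) d),
    position d v < Fintype.card (TVert (Fin n) d)
  | 0, _ => Nat.one_pos
  | d + 1, v => by
    obtain rfl | ⟨x, y, rfl⟩ := eq_handle_or_eq_inCopy v
    · rw [position_handle, card_TVert_succ]
      exact Nat.succ_pos _
    · rw [position_inCopy, card_TVert_succ, Fintype.card_fin]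
      have := Nat.mul_le_mul_right (Fintype.card (TVert (Fin n) d)) x.2
      have := position_lt_card d y
      linarith

theorem position_inCopy_lt_inCopy {x x' : Fin n} {y y' : TVert (Fin n) d} :
    position (d + 1) (inCopy x y) < position (d + 1) (inCopy x' y') ↔
      x < x' ∨ x = x' ∧ position d y < position d y' := by
  have hblock {x x' : Fin n} (y y' : TVert (Fin n) d) (h : x < x') :
      position (d + 1) (inCopy x y) < position (d + 1) (inCopy x' y') := by
    rw [position_inCopy, position_inCopy]
    have := Nat.mul_le_mul_right (Fintype.card (TVert (Fin n) d)) h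
    have := position_lt_card d y
    linarith
  rcases lt_trichotomy x x' with h | rfl | h
  · simp only [h, hblock y y' h, true_or]
  · simp only [position_inCopy, lt_self_iff_false, true_and, false_or, add_lt_add_iff_left,
      add_lt_add_iff_right]
  · simp only [h.not_gt, h.ne', (hblock y' y h).not_gt, false_and, or_self]

theorem position_injective : ∀ d : ℕ, Function.Injective (position (n := n) d)
  | 0, _, _, _ => rfl
  | d + 1, v, v', h => by
    obtain rfl | ⟨x, y, rfl⟩ := eq_handle_or_eq_inCopy v <;>
      obtain rfl | ⟨x', y', rfl⟩ := eq_handle_or_eq_inCopy v'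
    · rfl
    · exact absurd h (Nat.succ_ne_zero _).symm
    · exact absurd h (Nat.succ_ne_zero _)
    · have hlt := position_inCopy_lt_inCopy.not.1 h.not_lt
      have hgt := position_inCopy_lt_inCopy.not.1 h.not_gt
      have heq : x = x' ∧ position d y = position d y' := by grind
      rw [heq.1, position_injective d heq.2]

theorem isNoncrossing_position : ∀ d : ℕ, IsNoncrossing (T d (pathGraph n)) (position d)
  | 0 => fun _ _ _ _ h => h.elim
  | d + 1 => fun u v u' v' h h' huu' hu'v hvv' => by
    obtain ⟨x', y', rfl⟩ := (eq_handle_or_eq_inCopy u').resolve_left (ne_handle_of_position_lt huu')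
    obtain ⟨x, w, rfl⟩ := (eq_handle_or_eq_inCopy v).resolve_left (ne_handle_of_position_lt hu'v)
    obtain ⟨z', w', rfl⟩ := (eq_handle_or_eq_inCopy v').resolve_left (ne_handle_of_position_lt hvv')
    rw [position_inCopy_lt_inCopy] at hu'v hvv'
    obtain rfl : x = x' := by
      rcases T_adj_inCopy.1 h' with ⟨rfl, -⟩ | ⟨hadj, rfl, rfl⟩
      · grind
      · have := pathGraph_adj.1 hadj
        rw [position_handle] at hu'v hvv'
        grind
    have hyw : position d y' < position d w := by simpa using hu'v
    obtain ⟨y, rfl, hy⟩ := exists_adj_of_T_adj_inCopy h (ne_handle_of_position_lt hyw)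
    have hyy' : position d y < position d y' := by simpa [position_inCopy_lt_inCopy] using huu'
    obtain ⟨w'', heq, hw''⟩ := exists_adj_of_T_adj_inCopy h'.symm (ne_handle_of_position_lt hyy')
    obtain ⟨rfl, rfl⟩ := inCopy_inj.1 heq
    exact isNoncrossing_position d hy hw''.symm hyy' hyw (by simpa using hvv')

theorem isOuterplanar_T_pathGraph (d n : ℕ) : IsOuterplanar (T d (pathGraph n)) :=
  isOuterplanar_of_isNoncrossing (Nat.cast_injective.comp (position_injective d))
    ((isNoncrossing_position d).comp_strictMono Nat.strictMono_cast)

end Position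

end TdFragile

theorem mainTheorem7_general :
    (∀ d a n : ℕ, 2 ^ a ≤ n →
      a * d + 1 ≤ TdFragile.treedepth (TdFragile.T d (SimpleGraph.pathGraph n))) ∧
    (∀ d n : ℕ, TdFragile.IsOuterplanar (TdFragile.T d (SimpleGraph.pathGraph n))) ∧
    (∃ c : ℝ, 0 < c ∧ ∃ a₀ : ℕ, ∀ a d n : ℕ, a₀ ≤ a → a ≤ d → a ≤ n → ∀ r : ℕ → ℝ≥0,
      TdFragile.FractionallyFragile TdFragile.td r (TdFragile.T d (SimpleGraph.pathGraph n)) →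
      c * ((a : ℝ) * Real.log (a : ℝ)) ≤ (r a : ℝ)) ∧
    (∀ r : ℕ → ℝ≥0,
      (∀ (V : Type) [Fintype V] (G : SimpleGraph V), TdFragile.IsOuterplanar G →
        TdFragile.FractionallyFragile TdFragile.td r G) →
      (fun a : ℕ => (a : ℝ) * Real.log (a : ℝ)) =O[Filter.atTop] (fun a : ℕ => (r a : ℝ))) := by
  have hrate {a d n : ℕ} (ha : 256 ≤ a) (had : a ≤ d) (han : a ≤ n) {r : ℕ → ℝ≥0}
      (h : TdFragile.FractionallyFragile TdFragile.td r
        (TdFragile.T d (SimpleGraph.pathGraph n))) :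
      1 / 16 * ((a : ℝ) * Real.log a) ≤ r a := by
    have : NeZero n := ⟨by omega⟩
    exact h.mul_log_le le_rfl ha had (by rwa [Fintype.card_fin])
  refine ⟨fun d a n hn => TdFragile.mul_add_one_le_treedepth_T le_rfl (by rwa [Fintype.card_fin]) d,
    TdFragile.isOuterplanar_T_pathGraph,
    ⟨1 / 16, by norm_num, 256, fun a d n ha had han r h => hrate ha had han h⟩, fun r h => ?_⟩
  refine Asymptotics.IsBigO.of_bound 16 ?_
  filter_upwards [Filter.eventually_ge_atTop 256] with a ha
  have hle := hrate ha le_rfl le_rfl (h _ _ (TdFragile.isOuterplanar_T_pathGraph a a))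
  have hlog : 0 ≤ (a : ℝ) * Real.log a := mul_nonneg a.cast_nonneg (Real.log_natCast_nonneg a)
  rw [Real.norm_of_nonneg hlog, Real.norm_of_nonneg (r a).coe_nonneg]
  linarith

theorem mainTheorem7 :
    -- the treedepth of `T_d(P_n)`
    (∀ d a n : ℕ, 1 ≤ a → 2 ^ a ≤ n →
      a * d + 1 ≤ TdFragile.treedepth (TdFragile.T d (SimpleGraph.pathGraph n))) ∧
    -- the graphs `T_d(P_d)` are outerplanar, and they witness the lower bound on the rate
    (∀ d : ℕ, TdFragile.IsOuterplanar (TdFragile.T d (SimpleGraph.pathGraph d))) ∧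
    (∃ c : ℝ, 0 < c ∧ ∃ a₀ : ℕ, ∀ a d : ℕ, a₀ ≤ a → a ≤ d →
      ∀ r : ℕ → ℝ≥0, Monotone r →
        TdFragile.FractionallyFragile TdFragile.td r
          (TdFragile.T d (SimpleGraph.pathGraph d)) →
        c * ((a : ℝ) * Real.log (a : ℝ)) ≤ (r a : ℝ)) ∧
    -- the lower bound for the class of all outerplanar graphs
    (∀ r : ℕ → ℝ≥0, Monotone r →
      (∀ (V : Type) [Fintype V] (G : SimpleGraph V), TdFragile.IsOuterplanar G →
        TdFragile.FractionallyFragile TdFragile.td r G) →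
      (fun a : ℕ => (a : ℝ) * Real.log (a : ℝ)) =O[Filter.atTop] (fun a : ℕ => (r a : ℝ))) := by
  obtain ⟨h₁, h₂, ⟨c, hc, a₀, h₃⟩, h₄⟩ := mainTheorem7_general
  exact ⟨fun d a n _ => h₁ d a n, fun d => h₂ d d,
    ⟨c, hc, a₀, fun a d ha had r _ => h₃ a d d ha had had r⟩, fun r _ => h₄ r⟩
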